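/- Let $X$ be a finite set of cardinality $n$ and let $S:X\times X\to X\times X$, $S(x,y)=(g_x(y),f_y(x))$, be a non-degenerate symmetric set-theoretical solution of the quantum Yang--Baxter equation; that is, all the maps $f_x,g_x:X\to X$ are bijective, $S\circ S=\mathrm{id}_{X\times X}$, and $S^{12}S^{23}S^{12}=S^{23}S^{12}S^{23}$ on $X^3$, where $S^{i\,i+1}$ is $S$ acting on the $i$th and $(i+1)$th components. Let $$M(X,S)=\langle X\mid xy=g_x(y)f_y(x);\ x,y\in X,\ S(x,y)\neq(x,y)\rangle$$ be its structure monoid, and let $\ell(a)$ be the common length of all words on $X$ that represent $a\in M(X,S)$. A Garside element of a monoid is an element that has the same left divisors as right divisors and whose divisors generate the monoid; *the* Garside element is the one that both left divides and right divides every Garside element. Then $M(X,S)$ has a unique such smallest Garside element $\Delta$. Write $\mathrm{Div}(\Delta)$ for its set of divisors, whose members are the simple elements of $M(X,S)$. 1. Every $a\in\mathrm{Div}(\Delta)$ is represented by exactly $\ell(a)!$ words on $X$. 2. For every integer $k\ge 0$, the number of simple elements of length $k$ is $\binom{n}{k}$ (which is $0$ for $k>n$), and so $\mathrm{Div}(\Delta)$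 has cardinality $2^n$. -/

import Mathlib

namespace SetYB

section Garside

variable {M : Type*} [Monoid M]

/-- `f` is a left divisor of `g`: there is `h` with `g = f h`. -/
def IsLeftDivisor (f g : M) : Prop := ∃ h, g = f * h

/-- `f` is a right divisor of `g`: there is `h` with `g = h f`. -/
def IsRightDivisor (f g : M) : Prop := ∃ h, g = h * f

/-- An element is balanced if its left divisors are exactly its right divisors. -/
def IsBalanced (d : M) : Prop := ∀ a : M, IsLeftDivisor a d ↔ IsRightDivisor a d

/-- `Div d`, the set of (left) divisors; it is used for balanced elements `d` only, for which the
left divisors and the right divisors coincide. -/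
def divisors (d : M) : Set M := {a | IsLeftDivisor a d}

/-- A Garside element: a balanced element whose divisors generate the monoid. -/
def IsGarsideElement (d : M) : Prop :=
  IsBalanced d ∧ Submonoid.closure (divisors d) = ⊤

/-- `d` is *the* Garside element: it is a Garside element, and it is the smallest one, both for
left divisibility and for right divisibility. -/
def IsTheGarsideElement (d : M) : Prop :=
  IsGarsideElement d ∧ ∀ e : M, IsGarsideElement e → IsLeftDivisor d e ∧ IsRightDivisor d e

end Garside

variable {X : Type*}

/-- The map `g_x`, where `S (x, y) = (g_x y, f_y x)`. -/
def g (S : X × X → X × X) (x : X) : X → X := fun y => (S (x, y)).1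

/-- The map `f_y`, where `S (x, y) = (g_x y, f_y x)`. -/
def f (S : X × X → X × X) (y : X) : X → X := fun x => (S (x, y)).2

/-- `S` acting on the first two components of `X³`. -/
def S12 (S : X × X → X × X) : X × X × X → X × X × X :=
  fun p => ((S (p.1, p.2.1)).1, (S (p.1, p.2.1)).2, p.2.2)

/-- `S` acting on the last two components of `X³`. -/
def S23 (S : X × X → X × X) : X × X × X → X × X × X :=
  fun p => (p.1, S p.2)

/-- All the maps `f_x` and `g_x` are bijections. -/
def IsNondegenerate (S : X × X → X × X) : Prop :=
  ∀ x, Function.Bijective (f S x) ∧ Function.Bijective (g S x)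

/-- `S² = id` and `S¹² S²³ S¹² = S²³ S¹² S²³`. -/
def IsSymmetric (S : X × X → X × X) : Prop :=
  S ∘ S = id ∧ S12 S ∘ S23 S ∘ S12 S = S23 S ∘ S12 S ∘ S23 S

/-- The defining relations `x y = g_x(y) f_y(x)`, for all `x, y` such that `S (x, y) ≠ (x, y)`. -/
def rels (S : X × X → X × X) (u v : FreeMonoid X) : Prop :=
  ∃ x y : X, S (x, y) ≠ (x, y) ∧
    u = FreeMonoid.of x * FreeMonoid.of y ∧
    v = FreeMonoid.of (g S x y) * FreeMonoid.of (f S y x)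

/-- The structure monoid `M(X, S)`. -/
abbrev StructureMonoid (S : X × X → X × X) : Type _ := PresentedMonoid (rels S)

/-- The words on `X` that represent the element `a` of `M(X, S)`. -/
def wordReps (S : X × X → X × X) (a : StructureMonoid S) : Set (FreeMonoid X) :=
  {w | PresentedMonoid.mk (rels S) w = a}

/-- The additive length on `M(X, S)` for which every generator has length one, as a morphism. -/
def lengthHom (S : X × X → X × X) : StructureMonoid S →* Multiplicative ℕ :=
  PresentedMonoid.lift (fun _ : X => Multiplicative.ofAdd 1) (by
    rintro u v ⟨x, y, -, rfl, rfl⟩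
    simp)

/-- The length `ℓ(a)` of an element of `M(X, S)`. -/
def length (S : X × X → X × X) (a : StructureMonoid S) : ℕ :=
  Multiplicative.toAdd (lengthHom S a)

/-- The length of an element is the length of any of its word representatives. -/
theorem length_eq_of_mem_wordReps (S : X × X → X × X) (a : StructureMonoid S)
    (w : FreeMonoid X) (hw : w ∈ wordReps S a) : length S a = w.length := by
  obtain rfl : PresentedMonoid.mk (rels S) w = a := hw
  induction w using FreeMonoid.inductionOn' with
  | one => simp [length]
  | of_mul x w ih =>
    have h1 : lengthHom S (PresentedMonoid.mk (rels S) (FreeMonoid.of x)) =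
        Multiplicative.ofAdd 1 := rfl
    simp only [length, map_mul, toAdd_mul, FreeMonoid.length_mul, FreeMonoid.length_of] at ih ⊢
    rw [ih, h1, toAdd_ofAdd]

end SetYB

/-! The structure monoid acts on multisets by affine maps; the image of the empty multiset is a
cocycle, `π(ab) = π(a) + a·π(b)`, which is bijective onto the free commutative monoid on `X`. Under
it left divisibility becomes inclusion of multisets (`isLeftDivisor_iff`), so `Δ` is the element
whose cocycle is `X` itself, and its divisors correspond to subsets of `X`, length to cardinality.
Words for `a` correspond through `unfold` to the orderings of `π(a)`, hence the factorial.
Bijectivity rests on `mk_fold_eq_of_perm`. -/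

namespace SetYB

/-! ### Identities between letters -/

section Letters

variable {X : Type*} {S : X × X → X × X}

/-- The map `g_x` as a permutation. -/
noncomputable def gPerm (hn : IsNondegenerate S) (x : X) : Equiv.Perm X :=
  Equiv.ofBijective (g S x) (hn x).2

theorem gPerm_apply (hn : IsNondegenerate S) (x y : X) : gPerm hn x y = g S x y := rfl

theorem g_g_f (hs : IsSymmetric S) (x y : X) : g S (g S x y) (f S y x) = x :=
  congrArg Prod.fst (congrFun hs.1 (x, y))

/-- This is the first coordinate of the braid relation. -/
theorem g_comp_g (hs : IsSymmetric S) (x y z : X) :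
    g S x (g S y z) = g S (g S x y) (g S (f S y x) z) :=
  (congrArg Prod.fst (congrFun hs.2 (x, y, z))).symm

theorem gPerm_mul_gPerm (hn : IsNondegenerate S) (hs : IsSymmetric S) (x y : X) :
    gPerm hn x * gPerm hn y = gPerm hn (g S x y) * gPerm hn (f S y x) :=
  Equiv.ext fun z => g_comp_g hs x y z

theorem mk_of_mul_of (x y : X) :
    PresentedMonoid.mk (rels S) (FreeMonoid.of x * FreeMonoid.of y) =
      PresentedMonoid.mk (rels S) (FreeMonoid.of (g S x y) * FreeMonoid.of (f S y x)) := by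
  by_cases h : S (x, y) = (x, y)
  · have h1 : g S x y = x := congrArg Prod.fst h
    have h2 : f S y x = y := congrArg Prod.snd h
    rw [h1, h2]
  · exact Quotient.sound (ConGen.Rel.of _ _ ⟨x, y, h, rfl, rfl⟩)

end Letters

/-! ### The bijective cocycle -/

section Cocycle

variable {X : Type*} {S : X × X → X × X} (hn : IsNondegenerate S) (hs : IsSymmetric S)

/-- The action of the structure monoid on `X` for which a generator `x` acts as `g_x`. -/
noncomputable def permHom : StructureMonoid S →* Equiv.Perm X :=
  PresentedMonoid.lift (gPerm hn) (by
    rintro u v ⟨x, y, -, rfl, rfl⟩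
    simpa using gPerm_mul_gPerm hn hs x y)

/-- The affine map `m ↦ {x} + g_x m` on multisets. -/
noncomputable def affineMap (x : X) : Function.End (Multiset X) :=
  fun m => x ::ₘ m.map (gPerm hn x)

theorem affineMap_mul_affineMap (x y : X) (m : Multiset X) :
    (affineMap hn x * affineMap hn y) m =
      x ::ₘ g S x y ::ₘ m.map (gPerm hn x * gPerm hn y) := by
  change x ::ₘ (y ::ₘ m.map (gPerm hn y)).map (gPerm hn x) = _
  rw [Multiset.map_cons, Multiset.map_map]
  rfl

/-- The affine action of the structure monoid on multisets for which a generator `x` acts as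
`m ↦ {x} + g_x m`. -/
noncomputable def affineHom : StructureMonoid S →* Function.End (Multiset X) :=
  PresentedMonoid.lift (affineMap hn) (by
    rintro u v ⟨x, y, -, rfl, rfl⟩
    rw [map_mul, map_mul, FreeMonoid.lift_eval_of, FreeMonoid.lift_eval_of,
      FreeMonoid.lift_eval_of, FreeMonoid.lift_eval_of]
    funext m
    -- Involutivity makes both sides add the letters `x` and `g_x(y)`, in opposite orders; the braid
    -- relation equates the linear parts.
    rw [affineMap_mul_affineMap, affineMap_mul_affineMap, g_g_f hs, ← gPerm_mul_gPerm hn hs,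
      Multiset.cons_swap])

/-- The bijective cocycle from the structure monoid to the free commutative monoid on `X`. -/
noncomputable def cocycle (a : StructureMonoid S) : Multiset X := affineHom hn hs a 0

theorem affineHom_apply (a : StructureMonoid S) (m : Multiset X) :
    affineHom hn hs a m = cocycle hn hs a + m.map (permHom hn hs a) := by
  obtain ⟨w, rfl⟩ := PresentedMonoid.surjective_mk a
  induction w using FreeMonoid.inductionOn' generalizing m with
  | one =>
    change m = 0 + m.map id
    simp
  | of_mul x w ih =>
    have h : ∀ m, affineHom hn hs (PresentedMonoid.mk (rels S) (FreeMonoid.of x * w)) m =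
        x ::ₘ (affineHom hn hs (PresentedMonoid.mk (rels S) w) m).map (gPerm hn x) := by
      intro m
      rw [map_mul, map_mul]
      rfl
    have h' : permHom hn hs (PresentedMonoid.mk (rels S) (FreeMonoid.of x * w)) =
        gPerm hn x * permHom hn hs (PresentedMonoid.mk (rels S) w) := by
      rw [map_mul, map_mul]
      rfl
    rw [cocycle, h, h, ih, ih 0, h']
    simp [Multiset.map_map, Function.comp_def]

theorem cocycle_mul (a b : StructureMonoid S) :
    cocycle hn hs (a * b) = cocycle hn hs a + (cocycle hn hs b).map (permHom hn hs a) := by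
  rw [← affineHom_apply, cocycle, map_mul]
  rfl

theorem cocycle_one : cocycle hn hs (1 : StructureMonoid S) = 0 := by
  rw [cocycle, map_one]
  rfl

theorem cocycle_of (x : X) : cocycle hn hs (PresentedMonoid.of (rels S) x) = {x} := rfl

/-- The sequence of letters added one after the other to the cocycle along a word. -/
noncomputable def unfold : List X → List X
  | [] => []
  | x :: w => x :: (unfold w).map (gPerm hn x)

/-- The word that unfolds to the image of a given sequence under a permutation. -/
noncomputable def fold : Equiv.Perm X → List X → List X
  | _, [] => []
  | σ, x :: l => σ x :: fold ((gPerm hn (σ x))⁻¹ * σ) l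

theorem unfold_fold (σ : Equiv.Perm X) (l : List X) : unfold hn (fold hn σ l) = l.map σ := by
  induction l generalizing σ with
  | nil => rfl
  | cons x l ih => simp [fold, unfold, ih]

theorem unfold_injective : Function.Injective (unfold hn) := by
  intro w w' h
  induction w generalizing w' with
  | nil => cases w' with
    | nil => rfl
    | cons y w' => simp [unfold] at h
  | cons x w ih => cases w' with
    | nil => simp [unfold] at h
    | cons y w' =>
      simp only [unfold, List.cons.injEq] at h
      obtain ⟨rfl, h⟩ := h
      rw [ih (List.map_injective_iff.2 (gPerm hn x).injective h)]

theorem unfold_bijective : Function.Bijective (unfold hn) :=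
  ⟨unfold_injective hn, fun l => ⟨fold hn 1 l, by simp [unfold_fold]⟩⟩

theorem cocycle_mk (w : List X) :
    cocycle hn hs (PresentedMonoid.mk (rels S) (FreeMonoid.ofList w)) =
      (unfold hn w : Multiset X) := by
  induction w with
  | nil => exact cocycle_one hn hs
  | cons x w ih =>
    rw [FreeMonoid.ofList_cons, map_mul, cocycle_mul, ih]
    change {x} + Multiset.map (gPerm hn x) _ = _
    simp [unfold]

include hs in
-- Swapping two adjacent letters of a sequence amounts to one application of `S` in the folded word,
-- and leaves the permutation passed to the rest unchanged.
theorem mk_fold_eq_of_perm {l l' : List X} (h : l.Perm l') (σ : Equiv.Perm X) :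
    PresentedMonoid.mk (rels S) (FreeMonoid.ofList (fold hn σ l)) =
      PresentedMonoid.mk (rels S) (FreeMonoid.ofList (fold hn σ l')) := by
  induction h generalizing σ with
  | nil => rfl
  | cons x _ ih => simp only [fold, FreeMonoid.ofList_cons, map_mul, ih]
  | swap x y l =>
    -- That is, `S(u, g_u⁻¹ v) = (v, g_v⁻¹ u)`.
    have key : ∀ u v : X, f S ((gPerm hn u)⁻¹ v) u = (gPerm hn v)⁻¹ u := by
      intro u v
      have h := g_g_f hs u ((gPerm hn u)⁻¹ v)
      rw [← gPerm_apply hn u, Equiv.Perm.eq_inv_iff_eq.1 rfl, ← gPerm_apply hn] at h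
      exact Equiv.Perm.eq_inv_iff_eq.2 h
    have hg : g S (σ y) ((gPerm hn (σ y))⁻¹ (σ x)) = σ x := by
      rw [← gPerm_apply hn, Equiv.Perm.eq_inv_iff_eq.1 rfl]
    have hp := gPerm_mul_gPerm hn hs (σ y) ((gPerm hn (σ y))⁻¹ (σ x))
    have hm := mk_of_mul_of (S := S) (σ y) ((gPerm hn (σ y))⁻¹ (σ x))
    rw [hg, key] at hp hm
    simp only [fold, FreeMonoid.ofList_cons, Equiv.Perm.mul_apply, ← mul_assoc, ← mul_inv_rev, hp]
    rw [map_mul, hm, ← map_mul]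
  | trans _ _ ih ih' => rw [ih, ih']

theorem fold_unfold (w : List X) : fold hn 1 (unfold hn w) = w :=
  unfold_injective hn (by simp [unfold_fold])

theorem cocycle_injective : Function.Injective (cocycle hn hs) := by
  intro a b h
  obtain ⟨w, rfl⟩ := PresentedMonoid.surjective_mk a
  obtain ⟨w', rfl⟩ := PresentedMonoid.surjective_mk b
  have h' := (cocycle_mk hn hs w.toList).symm.trans (h.trans (cocycle_mk hn hs w'.toList))
  have := mk_fold_eq_of_perm hn hs (Multiset.coe_eq_coe.1 h') 1
  rwa [fold_unfold, fold_unfold] at this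

theorem cocycle_surjective : Function.Surjective (cocycle hn hs) := by
  intro m
  induction m using Quotient.inductionOn with
  | h l =>
    obtain ⟨w, rfl⟩ := (unfold_bijective hn).2 l
    exact ⟨_, cocycle_mk hn hs w⟩

theorem length_unfold (w : List X) : (unfold hn w).length = w.length := by
  induction w with
  | nil => rfl
  | cons x w ih => simp [unfold, ih]

theorem length_eq_card_cocycle (a : StructureMonoid S) :
    length S a = (cocycle hn hs a).card := by
  obtain ⟨w, rfl⟩ := PresentedMonoid.surjective_mk a
  rw [length_eq_of_mem_wordReps S _ w rfl]
  change _ = (cocycle hn hs (PresentedMonoid.mk (rels S) (FreeMonoid.ofList w.toList))).card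
  rw [cocycle_mk, Multiset.coe_card, length_unfold]
  rfl

/-! ### Divisibility, cancellation and generators -/

theorem isLeftDivisor_iff (a b : StructureMonoid S) :
    IsLeftDivisor a b ↔ cocycle hn hs a ≤ cocycle hn hs b := by
  constructor
  · rintro ⟨h, rfl⟩
    rw [cocycle_mul]
    exact Multiset.le_add_right _ _
  · intro h
    obtain ⟨m, hm⟩ := Multiset.le_iff_exists_add.1 h
    -- The complement is untwisted by `a` before being lifted, since `π(ac)` twists `π(c)` by `a`.
    obtain ⟨c, hc⟩ := cocycle_surjective hn hs (m.map (permHom hn hs a).symm)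
    refine ⟨c, cocycle_injective hn hs ?_⟩
    rw [cocycle_mul, hc, hm, Multiset.map_map]
    simp

include hn hs in
/-- The structure monoid is right cancellative. -/
theorem mul_right_cancel_structureMonoid {a b c : StructureMonoid S} (h : a * c = b * c) :
    a = b := by
  -- Cancelling in the permutation group shows that `a` and `b` twist `π(c)` alike.
  have h1 : permHom hn hs a = permHom hn hs b := by
    have := congrArg (permHom hn hs) h
    rwa [map_mul, map_mul, mul_left_inj] at this
  have h2 := congrArg (cocycle hn hs) h
  rw [cocycle_mul, cocycle_mul, h1, add_left_inj] at h2
  exact cocycle_injective hn hs h2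

include hn hs in
theorem isLeftDivisor_antisymm {a b : StructureMonoid S} (h : IsLeftDivisor a b)
    (h' : IsLeftDivisor b a) : a = b :=
  cocycle_injective hn hs
    (le_antisymm ((isLeftDivisor_iff hn hs _ _).1 h) ((isLeftDivisor_iff hn hs _ _).1 h'))

include hn hs in
/-- A set that generates the structure monoid contains the generators `X`. -/
theorem of_mem_of_closure_eq_top {A : Set (StructureMonoid S)} (hA : Submonoid.closure A = ⊤)
    (x : X) : PresentedMonoid.of (rels S) x ∈ A := by
  have key : ∀ a ∈ Submonoid.closure A, ∀ x, cocycle hn hs a = {x} →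
      PresentedMonoid.of (rels S) x ∈ A := by
    intro a ha
    induction ha using Submonoid.closure_induction with
    | mem a ha =>
      intro x hx
      rwa [← cocycle_injective hn hs (hx.trans (cocycle_of hn hs x).symm)]
    | one =>
      intro x hx
      rw [cocycle_one] at hx
      exact absurd hx.symm (Multiset.singleton_ne_zero x)
    | mul a b _ _ iha ihb =>
      intro x hx
      have hc := congrArg Multiset.card hx
      rw [cocycle_mul, Multiset.card_add, Multiset.card_map, Multiset.card_singleton] at hc
      rcases Nat.add_eq_one_iff.1 hc with ⟨h, -⟩ | ⟨-, h⟩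
      · obtain rfl : a = 1 := cocycle_injective hn hs
          ((Multiset.card_eq_zero.1 h).trans (cocycle_one hn hs).symm)
        exact ihb x (by rwa [one_mul] at hx)
      · obtain rfl : b = 1 := cocycle_injective hn hs
          ((Multiset.card_eq_zero.1 h).trans (cocycle_one hn hs).symm)
        exact iha x (by rwa [mul_one] at hx)
  exact key _ (hA ▸ Submonoid.mem_top _) x (cocycle_of hn hs x)

/-- The number of words representing an element with multiplicity-free cocycle. -/
theorem encard_wordReps {a : StructureMonoid S} (ha : (cocycle hn hs a).Nodup) :
    (wordReps S a).encard = ((length S a).factorial : ℕ∞) := by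
  classical
  obtain ⟨l, hl⟩ := Quotient.exists_rep (cocycle hn hs a)
  change (l : Multiset X) = _ at hl
  -- A word represents `a` exactly when its unfolding is an ordering of `π(a)`.
  have himg : (unfold hn) '' (FreeMonoid.toList '' wordReps S a) =
      (l.permutations.toFinset : Set (List X)) := by
    ext v
    obtain ⟨w, rfl⟩ := (unfold_bijective hn).2 v
    rw [(unfold_injective hn).mem_set_image]
    simp only [Finset.mem_coe, List.mem_toFinset, List.mem_permutations]
    rw [← Multiset.coe_eq_coe, hl, ← cocycle_mk hn hs, (cocycle_injective hn hs).eq_iff]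
    constructor
    · rintro ⟨w, hw, rfl⟩
      exact hw
    · intro h
      exact ⟨FreeMonoid.ofList w, h, rfl⟩
  have hnd : l.Nodup := by
    rw [← hl] at ha
    exact Multiset.coe_nodup.1 ha
  rw [← (FreeMonoid.toList.injective).encard_image, ← (unfold_injective hn).encard_image, himg,
    Set.encard_coe_eq_coe_finsetCard, List.toFinset_card_of_nodup (List.nodup_permutations l hnd),
    List.length_permutations, length_eq_card_cocycle hn hs, ← hl, Multiset.coe_card]

end Cocycle

/-! ### The Garside element and its divisors -/

section Garside

variable {X : Type*} [Fintype X] {S : X × X → X × X} (hn : IsNondegenerate S)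
  (hs : IsSymmetric S) {d : StructureMonoid S} (hd : cocycle hn hs d = Finset.univ.val)

include hd

theorem isLeftDivisor_iff_nodup (a : StructureMonoid S) :
    IsLeftDivisor a d ↔ (cocycle hn hs a).Nodup := by
  rw [isLeftDivisor_iff hn hs, hd]
  refine ⟨fun h => Multiset.nodup_of_le h Finset.univ.nodup, fun h => ?_⟩
  exact (Multiset.le_iff_subset h).2 fun x _ => Finset.mem_univ x

theorem image_divisors_length (k : ℕ) :
    cocycle hn hs '' {a | a ∈ divisors d ∧ length S a = k} =
      Finset.val '' ((Finset.univ : Finset X).powersetCard k : Set (Finset X)) := by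
  ext m
  obtain ⟨a, rfl⟩ := cocycle_surjective hn hs m
  rw [(cocycle_injective hn hs).mem_set_image]
  change IsLeftDivisor a d ∧ _ ↔ _
  rw [isLeftDivisor_iff_nodup hn hs hd, length_eq_card_cocycle hn hs]
  constructor
  · rintro ⟨h, rfl⟩
    exact ⟨⟨_, h⟩, by simp [Finset.card], rfl⟩
  · rintro ⟨s, h, h'⟩
    rw [← h']
    exact ⟨s.nodup, (Finset.mem_powersetCard.1 h).2⟩

theorem image_divisors :
    cocycle hn hs '' divisors d = Finset.val '' (Set.univ : Set (Finset X)) := by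
  ext m
  obtain ⟨a, rfl⟩ := cocycle_surjective hn hs m
  rw [(cocycle_injective hn hs).mem_set_image]
  change IsLeftDivisor a d ↔ _
  rw [isLeftDivisor_iff_nodup hn hs hd]
  constructor
  · intro h
    exact ⟨⟨_, h⟩, trivial, rfl⟩
  · rintro ⟨s, -, h⟩
    rw [← h]
    exact s.nodup

theorem encard_divisors_length (k : ℕ) :
    {a | a ∈ divisors d ∧ length S a = k}.encard = ((Fintype.card X).choose k : ℕ∞) := by
  rw [← (cocycle_injective hn hs).encard_image, image_divisors_length hn hs hd,
    Finset.val_injective.encard_image, Set.encard_coe_eq_coe_finsetCard, Finset.card_powersetCard,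
    Finset.card_univ]

theorem encard_divisors : (divisors d).encard = ((2 ^ Fintype.card X : ℕ) : ℕ∞) := by
  rw [← (cocycle_injective hn hs).encard_image, image_divisors hn hs hd,
    Finset.val_injective.encard_image, Set.encard_univ, ENat.card_eq_coe_fintype_card,
    Fintype.card_finset]

theorem isLeftDivisor_of_isRightDivisor {a : StructureMonoid S} (h : IsRightDivisor a d) :
    IsLeftDivisor a d := by
  obtain ⟨b, hb⟩ := h
  rw [isLeftDivisor_iff_nodup hn hs hd]
  have h1 : (cocycle hn hs (b * a)).Nodup := by
    rw [← hb, hd]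
    exact Finset.univ.nodup
  rw [cocycle_mul] at h1
  exact Multiset.Nodup.of_map _ (Multiset.nodup_of_le (Multiset.le_add_left _ _) h1)

theorem isBalanced_of_cocycle_eq_univ : IsBalanced d := by
  have hfin : (divisors d).Finite := by
    rw [← Set.encard_lt_top_iff, encard_divisors hn hs hd]
    exact ENat.natCast_lt_top _
  -- The map sending `a` to `c` with `d = a c` is injective by right cancellation, hence a bijection
  -- of the finite set of left divisors; so each of these is also a right divisor.
  choose c hc using fun a : divisors d => a.2
  have hmem : ∀ a, IsLeftDivisor (c a) d := fun a =>
    isLeftDivisor_of_isRightDivisor hn hs hd ⟨a, hc a⟩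
  have hinj : Function.Injective fun a : divisors d => (⟨c a, hmem a⟩ : divisors d) := by
    intro a b hab
    have hab' : c a = c b := congrArg Subtype.val hab
    have h := (hc a).symm.trans (hc b)
    rw [hab'] at h
    exact Subtype.ext (mul_right_cancel_structureMonoid hn hs h)
  have : Finite (divisors d) := hfin
  have hsurj := Finite.surjective_of_injective hinj
  intro a
  refine ⟨fun ha => ?_, isLeftDivisor_of_isRightDivisor hn hs hd⟩
  obtain ⟨b, hb⟩ := hsurj ⟨a, ha⟩
  obtain rfl : c b = a := congrArg Subtype.val hb
  exact ⟨b, hc b⟩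

theorem isTheGarsideElement_of_cocycle_eq_univ : IsTheGarsideElement d := by
  refine ⟨⟨isBalanced_of_cocycle_eq_univ hn hs hd, ?_⟩, fun e he => ?_⟩
  · refine top_unique ?_
    rw [← PresentedMonoid.closure_range_of (rels S)]
    refine Submonoid.closure_mono ?_
    rintro _ ⟨x, rfl⟩
    refine (isLeftDivisor_iff_nodup hn hs hd _).2 ?_
    rw [cocycle_of]
    exact Multiset.nodup_singleton x
  -- The divisors of `e` generate, so they include every letter, and `π(e)` contains all of `X`.
  · have h : IsLeftDivisor d e := by
      rw [isLeftDivisor_iff hn hs, hd, Multiset.le_iff_subset Finset.univ.nodup]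
      intro x _
      have hx := (isLeftDivisor_iff hn hs _ _).1 (of_mem_of_closure_eq_top hn hs he.2 x)
      rw [cocycle_of] at hx
      exact Multiset.singleton_le.1 hx
    exact ⟨h, (he.1 d).1 h⟩

end Garside

end SetYB

theorem mainTheorem7 {X : Type*} [Fintype X] (S : X × X → X × X)
    (hnondeg : SetYB.IsNondegenerate S) (hsymm : SetYB.IsSymmetric S) :
    (∃! d : SetYB.StructureMonoid S, SetYB.IsTheGarsideElement d) ∧
    ∀ d : SetYB.StructureMonoid S, SetYB.IsTheGarsideElement d →
      (∀ a ∈ SetYB.divisors d,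
        (SetYB.wordReps S a).encard = ((SetYB.length S a).factorial : ℕ∞)) ∧
      (∀ k : ℕ,
        {a | a ∈ SetYB.divisors d ∧ SetYB.length S a = k}.encard =
          ((Fintype.card X).choose k : ℕ∞)) ∧
      (SetYB.divisors d).encard = ((2 ^ Fintype.card X : ℕ) : ℕ∞) := by
  obtain ⟨d, hd⟩ := SetYB.cocycle_surjective hnondeg hsymm (Finset.univ : Finset X).val
  have hG := SetYB.isTheGarsideElement_of_cocycle_eq_univ hnondeg hsymm hd
  have huniq : ∀ e : SetYB.StructureMonoid S, SetYB.IsTheGarsideElement e → e = d :=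
    fun e he => SetYB.isLeftDivisor_antisymm hnondeg hsymm (he.2 d hG.1).1 (hG.2 e he.1).1
  refine ⟨⟨d, hG, huniq⟩, fun e he => ?_⟩
  obtain rfl := huniq e he
  exact ⟨fun a ha => SetYB.encard_wordReps hnondeg hsymm
      ((SetYB.isLeftDivisor_iff_nodup hnondeg hsymm hd a).1 ha),
    SetYB.encard_divisors_length hnondeg hsymm hd, SetYB.encard_divisors hnondeg hsymm hd⟩
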